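/- Let $k$ be an algebraically closed field, and let $A=kQ_A/I_A$ and $B=kQ_B/I_B$ be bound quiver algebras, where $Q_A$, $Q_B$ are finite connected quivers and $I_A$, $I_B$ are admissible ideals of the path algebras $kQ_A$, $kQ_B$. Suppose that $A$ is not simple (that is, $A\not\simeq k$) and that $A$ is not isomorphic, as a $k$-algebra, to $\mathbf{A}_2:=k(1\to 2)$, the path algebra of the quiver with two vertices and one arrow between them. If the underlying graph of $Q_B$ contains the graph $\mathbb{D}_4$ (one vertex joined to three other vertices) as a (not necessarily induced) subgraph, then $A\otimes_k B$ is representation-infinite, i.e. there are infinitely many isomorphism classes of finite-dimensional indecomposable $A\otimes_k B$-modules. -/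

import Mathlib

open scoped TensorProduct

namespace BoundQuiver

section PathAlgebra

/-- All paths of the quiver `V` (including the trivial path at each vertex). -/
abbrev TotalPath (V : Type*) [Quiver V] := Σ a b : V, Quiver.Path a b

/-- The path algebra `kV` of a quiver `V`: the vector space with basis the paths of `V`. -/
def PathAlgebra (k V : Type*) [Field k] [Quiver V] := TotalPath V →₀ k

namespace PathAlgebra

variable (k V : Type*) [Field k] [Quiver V]

noncomputable instance : AddCommGroup (PathAlgebra k V) :=
  inferInstanceAs (AddCommGroup (TotalPath V →₀ k))

noncomputable instance : Module k (PathAlgebra k V) :=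
  inferInstanceAs (Module k (TotalPath V →₀ k))

variable {V}

/-- The basis element of the path algebra given by a path. -/
noncomputable def ofPath (p : TotalPath V) : PathAlgebra k V := Finsupp.single p 1

open Classical in
/-- The product of two paths: `p` followed by `q` if `p` ends where `q` starts, else `0`. -/
noncomputable def pathMul (p q : TotalPath V) : PathAlgebra k V :=
  if h : p.2.1 = q.1 then ofPath k ⟨p.1, q.2.1, p.2.2.comp (q.2.2.cast h.symm rfl)⟩ else 0

theorem pathMul_comp {a b c : V} (p : Quiver.Path a b) (q : Quiver.Path b c) :
    pathMul k (⟨a, b, p⟩ : TotalPath V) ⟨b, c, q⟩ = ofPath k ⟨a, c, p.comp q⟩ := by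
  simp [pathMul]

theorem pathMul_ne {p q : TotalPath V} (h : p.2.1 ≠ q.1) : pathMul k p q = 0 := by
  simp [pathMul, h]

/-- The bilinear extension of the product of paths. -/
noncomputable def mulLin : PathAlgebra k V →ₗ[k] PathAlgebra k V →ₗ[k] PathAlgebra k V :=
  Finsupp.lift (PathAlgebra k V →ₗ[k] PathAlgebra k V) k (TotalPath V)
    fun p => Finsupp.lift (PathAlgebra k V) k (TotalPath V) fun q => pathMul k p q

noncomputable instance : Mul (PathAlgebra k V) := ⟨fun x y => mulLin k x y⟩

theorem mul_def (x y : PathAlgebra k V) : x * y = mulLin k x y := rfl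

theorem ofPath_mul_ofPath (p q : TotalPath V) :
    ofPath k p * ofPath k q = pathMul k p q := by
  have h : ∀ (M : Type _) [AddCommGroup M] [Module k M] (f : TotalPath V → M) (r : TotalPath V),
      Finsupp.lift M k (TotalPath V) f (ofPath k r) = f r := by
    intro M _ _ f r
    simp [ofPath]
  rw [mul_def, mulLin]
  erw [h, h]

variable {k} in
theorem linearMap_ext {M : Type*} [AddCommGroup M] [Module k M] {f g : PathAlgebra k V →ₗ[k] M}
    (h : ∀ p, f (ofPath k p) = g (ofPath k p)) : f = g :=
  Finsupp.lhom_ext' fun p => LinearMap.ext_ring (h p)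

theorem pathMul_assoc (p q r : TotalPath V) :
    pathMul k p q * ofPath k r = ofPath k p * pathMul k q r := by
  obtain ⟨a, b, p⟩ := p
  obtain ⟨c, d, q⟩ := q
  obtain ⟨e, f, r⟩ := r
  have z1 : ∀ x : PathAlgebra k V, 0 * x = 0 := fun x => by simp [mul_def]
  have z2 : ∀ x : PathAlgebra k V, x * 0 = 0 := fun x => by simp [mul_def]
  by_cases h : b = c
  · subst h
    by_cases h' : d = e
    · subst h'
      simp only [pathMul_comp, ofPath_mul_ofPath, Quiver.Path.comp_assoc]
    · rw [pathMul_comp, ofPath_mul_ofPath, pathMul_ne k (by exact h'), pathMul_ne k (by exact h'),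
        z2]
  · rw [pathMul_ne k (by exact h), z1]
    by_cases h' : d = e
    · subst h'
      rw [pathMul_comp, ofPath_mul_ofPath, pathMul_ne k (by exact h)]
    · rw [pathMul_ne k (by exact h'), z2]

variable {k} in
theorem induction_on {P : PathAlgebra k V → Prop} (x : PathAlgebra k V) (zero : P 0)
    (add : ∀ x y, P x → P y → P (x + y)) (smul : ∀ (c : k) (p : TotalPath V), P (c • ofPath k p)) :
    P x := by
  refine Finsupp.induction_linear (motive := P) x zero add fun p c => ?_
  have h : c • ofPath k p = (Finsupp.single p c : TotalPath V →₀ k) := by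
    have := Finsupp.smul_single_one p c
    exact this
  exact h ▸ smul c p

theorem assoc (x y z : PathAlgebra k V) : x * y * z = x * (y * z) := by
  have addL : ∀ x y z : PathAlgebra k V, (x + y) * z = x * z + y * z := by simp [mul_def]
  have addR : ∀ x y z : PathAlgebra k V, x * (y + z) = x * y + x * z := by simp [mul_def]
  have zL : ∀ z : PathAlgebra k V, 0 * z = 0 := by simp [mul_def]
  have zR : ∀ z : PathAlgebra k V, z * 0 = 0 := by simp [mul_def]
  have sL : ∀ (c : k) (x y : PathAlgebra k V), (c • x) * y = c • (x * y) := by simp [mul_def]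
  have sR : ∀ (c : k) (x y : PathAlgebra k V), x * (c • y) = c • (x * y) := by simp [mul_def]
  induction x using induction_on with
  | zero => simp only [zL]
  | add x x' hx hx' => simp only [addL, hx, hx']
  | smul c p =>
    induction y using induction_on with
    | zero => simp only [zL, zR]
    | add y y' hy hy' => simp only [addL, addR, hy, hy']
    | smul d q =>
      induction z using induction_on with
      | zero => simp only [zR]
      | add z z' hz hz' => simp only [addR, hz, hz']
      | smul e r => simp only [sL, sR, ofPath_mul_ofPath, pathMul_assoc]

section Unital

variable [Fintype V]

/-- The unit is the sum of the trivial paths. -/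
noncomputable instance : One (PathAlgebra k V) :=
  ⟨∑ a : V, ofPath k ⟨a, a, Quiver.Path.nil⟩⟩

theorem one_def : (1 : PathAlgebra k V) = ∑ a : V, ofPath k ⟨a, a, Quiver.Path.nil⟩ := rfl

theorem unit_mul (x : PathAlgebra k V) : 1 * x = x := by
  rw [mul_def]
  suffices h : mulLin k (1 : PathAlgebra k V) = LinearMap.id from congrArg (fun f => f x) h
  refine linearMap_ext fun p => ?_
  obtain ⟨a, b, p⟩ := p
  rw [one_def, map_sum, LinearMap.sum_apply, Finset.sum_eq_single a]
  · rw [← mul_def, ofPath_mul_ofPath, pathMul_comp, Quiver.Path.nil_comp, LinearMap.id_apply]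
  · intro c _ hc
    rw [← mul_def, ofPath_mul_ofPath, pathMul_ne k (by exact hc)]
  · simp

theorem mul_unit (x : PathAlgebra k V) : x * 1 = x := by
  rw [mul_def]
  suffices h : (mulLin k).flip (1 : PathAlgebra k V) = LinearMap.id from congrArg (fun f => f x) h
  refine linearMap_ext fun p => ?_
  obtain ⟨a, b, p⟩ := p
  rw [one_def, map_sum, LinearMap.sum_apply, Finset.sum_eq_single b]
  · rw [LinearMap.flip_apply, ← mul_def, ofPath_mul_ofPath, pathMul_comp, Quiver.Path.comp_nil,
      LinearMap.id_apply]
  · intro c _ hc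
    rw [LinearMap.flip_apply, ← mul_def, ofPath_mul_ofPath, pathMul_ne k (by exact hc.symm)]
  · simp

noncomputable instance : Ring (PathAlgebra k V) :=
  { (inferInstance : AddCommGroup (PathAlgebra k V)) with
    left_distrib := fun x y z => by simp [mul_def]
    right_distrib := fun x y z => by simp [mul_def]
    zero_mul := fun x => by simp [mul_def]
    mul_zero := fun x => by simp [mul_def]
    mul_assoc := assoc k
    one_mul := unit_mul k
    mul_one := mul_unit k }

noncomputable instance : Algebra k (PathAlgebra k V) :=
  Algebra.ofModule (fun c x y => by simp [mul_def]) (fun c x y => by simp [mul_def])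

end Unital

end PathAlgebra

end PathAlgebra

/-- The `m`-th power of the arrow ideal of the path algebra: the span of all paths of length at
least `m`. -/
noncomputable def arrowPower (k V : Type*) [Field k] [Quiver V] (m : ℕ) : Submodule k (PathAlgebra k V) :=
  Submodule.span k (PathAlgebra.ofPath k '' {p : TotalPath V | m ≤ p.2.2.length})

/-- A two-sided ideal `I` of the path algebra of a finite quiver is admissible if
`R ^ m ⊆ I ⊆ R ^ 2` for some `m ≥ 2`, where `R` is the arrow ideal. -/
def IsAdmissible {k V : Type*} [Field k] [Quiver V] [Fintype V] (I : Ideal (PathAlgebra k V)) :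
    Prop :=
  (∃ m : ℕ, 2 ≤ m ∧ arrowPower k V m ≤ I.restrictScalars k) ∧
    I.restrictScalars k ≤ arrowPower k V 2

/-- The underlying graph of a quiver, loops and multiplicities of edges being forgotten. -/
def underlyingGraph (V : Type*) [Quiver V] : SimpleGraph V :=
  SimpleGraph.fromRel fun a b => Nonempty (a ⟶ b)

/-- The graph `D₄`: the vertex `2` is joined to each of `0`, `1`, `3`. -/
def graphD4 : SimpleGraph (Fin 4) :=
  SimpleGraph.fromEdgeSet {s(0, 2), s(1, 2), s(2, 3)}

/-- The two vertices of the quiver `one ⟶ two`. -/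
inductive A2Vertex : Type
  | one
  | two

instance : Fintype A2Vertex where
  elems := ⟨[A2Vertex.one, A2Vertex.two], by simp⟩
  complete := fun x => by cases x <;> simp

/-- The single arrow of the quiver `one ⟶ two`. -/
inductive A2Arrow : A2Vertex → A2Vertex → Type
  | arrow : A2Arrow A2Vertex.one A2Vertex.two

instance : Quiver A2Vertex := ⟨A2Arrow⟩

/-- A ring (in the use below, a finite-dimensional algebra) is representation-finite if it has only
finitely many isomorphism classes of indecomposable finitely generated modules. -/
def RepresentationFinite.{u} (R : Type u) [Ring R] : Prop :=
  ∃ (n : ℕ) (F : Fin n → ModuleCat.{u} R), ∀ M : ModuleCat.{u} R,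
    Module.Finite R M → CategoryTheory.Indecomposable M → ∃ i, Nonempty (M ≅ F i)

/-- A ring is representation-infinite if it is not representation-finite. -/
def RepresentationInfinite (R : Type*) [Ring R] : Prop := ¬ RepresentationFinite R

end BoundQuiver

/-! ### Infinite families of indecomposables -/

namespace BoundQuiver

/-! The tensor product is governed by the product quiver, whose arrows pair an arrow of one factor
with a vertex of the other. Modules killed by all products of two arrows can be built on a space `X
⊕ Y`, each arrow mapping `X` to `Y`; they are representations of the separated quiver, in which
every vertex is split into a source copy and a target copy. It therefore suffices to find distinct
arrows of the product quiver that form a Euclidean diagram there, and to place on them a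
one-parameter family of representations with only scalar endomorphisms. Since `k` is infinite, this
gives infinitely many indecomposables (`representationInfinite_of_rigidFamily`).

The diagrams used are D̃₄, D̃₅ and Ẽ₆ (`fourSubspaces`, `twoStars`, `threeFlags`). As `A` is neither
`k` nor `k(1 → 2)`, two arrows of `Q_A` are adjacent (`hasAdjacentArrows`). If the three edges of D₄
all point into its centre `c`, or all out of it, they form D̃₄ together with one arrow of `Q_A`. In
the mixed orientations, two arrows of `Q_A` at a common vertex give D̃₄ if they are oriented there
like the two parallel edges of D₄, D̃₅ if oppositely, and Ẽ₆ if they are composable. -/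

open CategoryTheory Limits in
/-- A nonzero module whose only idempotent endomorphisms are `0` and `1` is indecomposable. -/
theorem indecomposable_of_idempotent {R : Type*} [Ring R] (M : ModuleCat R) [Nontrivial M]
    (h : ∀ e : M →ₗ[R] M, e ∘ₗ e = e → e = 0 ∨ e = LinearMap.id) : Indecomposable M := by
  refine ⟨fun hM => ?_, fun Y Z i => ?_⟩
  · exact not_subsingleton M (ModuleCat.isZero_iff_subsingleton.mp hM)
  · let f : M ⟶ M := i.hom ≫ biprod.fst ≫ biprod.inl ≫ i.inv
    have hf : f ≫ f = f := by simp [f]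
    have hf' : f.hom ∘ₗ f.hom = f.hom := by rw [← ModuleCat.hom_comp, hf]
    rcases h f.hom hf' with h0 | h1
    · left
      have hz : f = 0 := ModuleCat.hom_ext h0
      rw [IsZero.iff_id_eq_zero]
      calc 𝟙 Y = biprod.inl ≫ i.inv ≫ f ≫ i.hom ≫ biprod.fst := by simp [f]
        _ = 0 := by simp [hz]
    · right
      have hz : f = 𝟙 M := ModuleCat.hom_ext h1
      rw [IsZero.iff_id_eq_zero]
      calc 𝟙 Z = biprod.inr ≫ i.inv ≫ 𝟙 M ≫ i.hom ≫ biprod.snd := by simp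
        _ = 0 := by rw [← hz]; simp [f]

universe u v

/-- An infinite family of pairwise nonisomorphic modules without nontrivial idempotent
endomorphisms makes a ring representation-infinite. -/
theorem representationInfinite_of_family {R : Type (max u v)} [Ring R] {Λ : Type*} [Infinite Λ]
    (M : Λ → Type v) [∀ l, AddCommGroup (M l)] [∀ l, Module R (M l)] [∀ l, Module.Finite R (M l)]
    [∀ l, Nontrivial (M l)]
    (hidem : ∀ l (e : M l →ₗ[R] M l), e ∘ₗ e = e → e = 0 ∨ e = LinearMap.id)
    (hiso : ∀ l m, (M l ≃ₗ[R] M m) → l = m) : RepresentationInfinite R := by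
  rintro ⟨n, F, hF⟩
  -- `RepresentationFinite` tests modules in the universe of `R`, hence the `ULift`.
  have key : ∀ l, ∃ i, Nonempty (ModuleCat.of R (ULift.{u} (M l)) ≅ F i) := by
    intro l
    refine hF _ ?_ ?_
    · exact Module.Finite.equiv (ULift.moduleEquiv (R := R) (M := M l)).symm
    · refine indecomposable_of_idempotent _ fun e he => ?_
      let E := (ULift.moduleEquiv : ULift.{u} (M l) ≃ₗ[R] M l)
      have := hidem l (E.toLinearMap ∘ₗ e ∘ₗ E.symm.toLinearMap) (by
        ext x
        have := congrArg (fun g => E (g (E.symm x))) he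
        simpa using this)
      rcases this with h | h
      · left
        ext x
        have := congrArg (fun g => g (E x)) h
        simpa [E] using this
      · right
        ext x
        have := congrArg (fun g => g (E x)) h
        simpa [E] using this
  choose f hf using key
  obtain ⟨l, m, hlm, he⟩ := Finite.exists_ne_map_eq_of_infinite f
  obtain ⟨i⟩ := hf l
  obtain ⟨j⟩ := he ▸ hf m
  exact hlm <| hiso l m <| ULift.moduleEquiv.symm.trans ((i ≪≫ j.symm).toLinearEquiv.trans ULift.moduleEquiv)

/-! ### Modules given by matrix representations -/

/-- The space `kⁿ`, as a module over `R` through a matrix representation of `R`. -/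
@[nolint unusedArguments]
def MatrixModule {k R n : Type*} [Field k] [Ring R] [Algebra k R] [Fintype n] [DecidableEq n]
    (_ : R →ₐ[k] Matrix n n k) : Type _ := n → k

namespace MatrixModule

variable {k R n : Type*} [Field k] [Ring R] [Algebra k R] [Fintype n] [DecidableEq n]
  (ρ : R →ₐ[k] Matrix n n k)

instance : AddCommGroup (MatrixModule ρ) := inferInstanceAs (AddCommGroup (n → k))

instance : Module k (MatrixModule ρ) := inferInstanceAs (Module k (n → k))

noncomputable instance : Module R (MatrixModule ρ) :=
  Module.compHom (n → k)
    ((Matrix.toLinAlgEquiv' : Matrix n n k ≃ₐ[k] _).toAlgHom.comp ρ).toRingHom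

theorem smul_def (r : R) (x : MatrixModule ρ) : r • x = (ρ r).mulVec x := rfl

instance : IsScalarTower k R (MatrixModule ρ) :=
  ⟨fun c r (x : n → k) => (congrArg (fun A => A.mulVec x) (map_smul ρ c r)).trans
    (Matrix.smul_mulVec c (ρ r) x)⟩

instance [Nonempty n] : Nontrivial (MatrixModule ρ) := inferInstanceAs (Nontrivial (n → k))

instance : Module.Finite k (MatrixModule ρ) := inferInstanceAs (Module.Finite k (n → k))

instance : Module.Finite R (MatrixModule ρ) :=
  Module.Finite.of_restrictScalars_finite k R (MatrixModule ρ)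

end MatrixModule

/-- A one-parameter family of matrix representations, whose intertwiners from parameter `l` to
parameter `m` are scalars up to a square-zero part, with scalar `0` if `l ≠ m`. -/
theorem representationInfinite_of_matrix_family {k : Type v} [Field k] [Infinite k]
    {R : Type (max u v)} [Ring R] [Algebra k R] {n : Type} [Fintype n] [DecidableEq n] [Nonempty n]
    (ρ : k → (R →ₐ[k] Matrix n n k))
    (h : ∀ l m (Φ : Matrix n n k), (∀ r, Φ * ρ l r = ρ m r * Φ) →
      ∃ s : k, (s = 0 ∨ l = m) ∧ (Φ - Matrix.scalar n s) * (Φ - Matrix.scalar n s) = 0) :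
    RepresentationInfinite R := by
  have key : ∀ l m (f : (n → k) →ₗ[k] (n → k)),
      (∀ r x, f ((ρ l r).mulVec x) = (ρ m r).mulVec (f x)) →
      ∃ s : k, (s = 0 ∨ l = m) ∧ ∀ x, f (f x) - (2 * s) • f x + (s * s) • x = 0 := by
    intro l m f hf
    obtain ⟨s, hs, hz⟩ := h l m (LinearMap.toMatrix' f) (fun r => by
      apply Matrix.toLin'.injective
      refine LinearMap.ext fun x => ?_
      simp [Matrix.toLin'_mul, hf])
    refine ⟨s, hs, fun x => ?_⟩
    have := congrArg (fun A => Matrix.toLin' A x) hz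
    have hsc : ∀ x : n → k, Matrix.toLin' (Matrix.scalar n s) x = s • x := by
      intro x
      ext i
      simp [Matrix.mulVec_diagonal]
    simp only [Matrix.toLin'_mul, map_sub, Matrix.toLin'_toMatrix', LinearMap.comp_apply,
      LinearMap.sub_apply, hsc, map_smul, map_zero, LinearMap.zero_apply] at this
    rw [← this]
    module
  refine representationInfinite_of_family (fun l => MatrixModule (ρ l)) (fun l e he => ?_) (fun l m i => ?_)
  · obtain ⟨s, -, hs⟩ := key l l (e.restrictScalars k) fun r x => e.map_smul r x
    have he' : ∀ x, e (e x) = e x := fun x => congrArg (fun g => g x) he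
    -- For an idempotent the relation `(e - s)² = 0` becomes linear in `e`, which forces `e` to be a
    -- scalar. The coefficient `1 - 2s` is nonzero in every characteristic, since otherwise `s² = 0`
    -- and `1 = 0`.
    have h1 : ∀ x : MatrixModule (ρ l), (1 - 2 * s) • e x = -(s * s) • x := by
      intro x
      have := hs x
      change e (e x) - (2 * s) • e x + (s * s) • x = 0 at this
      rw [he'] at this
      linear_combination (norm := module) this
    by_cases h2 : 1 - 2 * s = 0
    · exfalso
      obtain ⟨x, hx⟩ := exists_ne (0 : MatrixModule (ρ l))
      have := h1 x
      rw [h2, zero_smul, eq_comm, smul_eq_zero, or_iff_left hx] at this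
      have hs0 : s = 0 := by simpa using this
      simp [hs0] at h2
    · have h3 : ∀ x : MatrixModule (ρ l), e x = ((1 - 2 * s)⁻¹ * -(s * s)) • x := by
        intro x
        rw [mul_smul, ← h1 x, smul_smul, inv_mul_cancel₀ h2, one_smul]
      set c := (1 - 2 * s)⁻¹ * -(s * s)
      by_cases hc : c = 0
      · left
        ext1 x
        rw [h3, hc, zero_smul, LinearMap.zero_apply]
      · right
        ext1 x
        have := he' x
        rw [h3 x, h3, smul_smul, mul_smul] at this
        rw [h3 x]
        exact smul_right_injective _ hc this
  · by_contra hlm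
    let f : (n → k) →ₗ[k] (n → k) := i.toLinearMap.restrictScalars k
    have hf : ∀ x, f x = 0 → x = 0 := fun x hx => i.injective (hx.trans (map_zero i).symm)
    -- For `l ≠ m` the scalar is `0`, so `f ∘ f = 0`, against injectivity.
    obtain ⟨s, hs, hz⟩ := key l m f fun r x => i.map_smul r x
    have hs0 : s = 0 := hs.resolve_right hlm
    subst hs0
    obtain ⟨x, hx⟩ := exists_ne (0 : n → k)
    exact hx (hf x (hf _ (by simpa using hz x)))

end BoundQuiver

/-! ### Homomorphisms out of path algebras and admissible quotients -/

namespace BoundQuiver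

/-- Elements of a ring `E` for the trivial paths and the arrows of a quiver, compatible with the
relations of the path algebra. -/
structure PathSystem (V E : Type*) [Quiver V] [Fintype V] [Ring E] where
  idem : V → E
  arr : ∀ {a b : V}, (a ⟶ b) → E
  idem_mul_self : ∀ a, idem a * idem a = idem a
  idem_mul_ne : ∀ a b, a ≠ b → idem a * idem b = 0
  sum_idem : ∑ a, idem a = 1
  idem_mul_arr : ∀ {a b} (α : a ⟶ b), idem a * arr α = arr α
  arr_mul_idem : ∀ {a b} (α : a ⟶ b), arr α * idem b = arr α

open PathAlgebra

variable {k V E : Type*} [Field k] [Quiver V] [Fintype V] [Ring E] [Algebra k E]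

namespace PathSystem

variable (D : PathSystem V E)

/-- The value of a path. -/
def value {a : V} : ∀ {b : V}, Quiver.Path a b → E
  | _, .nil => D.idem a
  | _, .cons p α => value p * D.arr α

theorem value_comp {a b c : V} (p : Quiver.Path a b) (q : Quiver.Path b c) :
    D.value (p.comp q) = D.value p * D.value q := by
  induction q with
  | nil =>
    cases p with
    | nil => simp [value, D.idem_mul_self]
    | cons p α => simp [value, mul_assoc, D.arr_mul_idem]
  | cons q α ih => simp [value, ih, mul_assoc]

theorem value_mul_idem {a b : V} (p : Quiver.Path a b) : D.value p * D.idem b = D.value p :=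
  (D.value_comp p .nil).symm

theorem idem_mul_value {a b : V} (p : Quiver.Path a b) : D.idem a * D.value p = D.value p := by
  have := D.value_comp .nil p
  rw [Quiver.Path.nil_comp] at this
  exact this.symm

/-- The linear extension of the value of a path. -/
noncomputable def liftLin (k : Type*) [Field k] [Algebra k E] : PathAlgebra k V →ₗ[k] E :=
  Finsupp.lift E k (TotalPath V) fun p => D.value p.2.2

theorem liftLin_ofPath (p : TotalPath V) : D.liftLin k (ofPath k p) = D.value p.2.2 := by
  have h : ∀ (f : TotalPath V → E), Finsupp.lift E k (TotalPath V) f (Finsupp.single p 1) = f p := by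
    simp
  exact h _

/-- The homomorphism from the path algebra determined by a system of elements. -/
noncomputable def lift (k : Type*) [Field k] [Algebra k E] : PathAlgebra k V →ₐ[k] E := by
  refine AlgHom.ofLinearMap (D.liftLin k) ?_ ?_
  · rw [one_def, map_sum, ← D.sum_idem]
    exact Finset.sum_congr rfl fun a _ => D.liftLin_ofPath _
  · suffices h : (LinearMap.mul k (PathAlgebra k V)).compr₂ (D.liftLin k) =
        (LinearMap.mul k E).compl₁₂ (D.liftLin k) (D.liftLin k) from
      fun x y => LinearMap.congr_fun (LinearMap.congr_fun h x) y
    refine linearMap_ext fun p => linearMap_ext fun q => ?_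
    simp only [LinearMap.compr₂_apply, LinearMap.compl₁₂_apply, LinearMap.mul_apply',
      liftLin_ofPath, ofPath_mul_ofPath]
    obtain ⟨a, b, p⟩ := p
    obtain ⟨c, d, q⟩ := q
    by_cases h : b = c
    · subst h
      rw [pathMul_comp, liftLin_ofPath, D.value_comp]
    · rw [pathMul_ne k (by exact h), map_zero]
      change 0 = D.value p * D.value q
      rw [← D.value_mul_idem p, ← D.idem_mul_value q, mul_assoc,
        ← mul_assoc (D.idem b), D.idem_mul_ne b c h, zero_mul, mul_zero]

theorem lift_ofPath (p : TotalPath V) : D.lift k (ofPath k p) = D.value p.2.2 :=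
  D.liftLin_ofPath p

theorem lift_vertex (a : V) : D.lift k (ofPath k ⟨a, a, .nil⟩) = D.idem a := D.lift_ofPath _

theorem lift_arrow {a b : V} (α : a ⟶ b) : D.lift k (ofPath k ⟨a, b, α.toPath⟩) = D.arr α :=
  (D.lift_ofPath _).trans (D.idem_mul_arr α)

theorem value_eq_zero (h0 : ∀ {a b c} (α : a ⟶ b) (β : b ⟶ c), D.arr α * D.arr β = 0)
    {a b : V} (p : Quiver.Path a b) (hp : 2 ≤ p.length) : D.value p = 0 := by
  match p, hp with
  | .cons (.cons p α) β, _ => simp [value, mul_assoc, h0]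

/-- An admissible ideal lies in the square of the arrow ideal, so a system with vanishing products
of arrows descends to every admissible quotient, whatever the relations are. -/
theorem lift_eq_zero (h0 : ∀ {a b c} (α : a ⟶ b) (β : b ⟶ c), D.arr α * D.arr β = 0)
    {x : PathAlgebra k V} (hx : x ∈ arrowPower k V 2) : D.lift k x = 0 := by
  suffices h : arrowPower k V 2 ≤ LinearMap.ker (D.lift k).toLinearMap from h hx
  refine Submodule.span_le.mpr ?_
  rintro _ ⟨p, hp, rfl⟩
  exact (D.lift_ofPath p).trans (D.value_eq_zero h0 _ hp)

/-- The homomorphism from the quotient by an admissible ideal, if products of arrows vanish. -/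
noncomputable def quotientLift (h0 : ∀ {a b c} (α : a ⟶ b) (β : b ⟶ c), D.arr α * D.arr β = 0)
    {I : Ideal (PathAlgebra k V)} [I.IsTwoSided] (hI : IsAdmissible I) :
    (PathAlgebra k V ⧸ I) →ₐ[k] E :=
  Ideal.Quotient.liftₐ I (D.lift k) fun _ hx => D.lift_eq_zero h0 (hI.2 hx)

theorem quotientLift_mk (h0 : ∀ {a b c} (α : a ⟶ b) (β : b ⟶ c), D.arr α * D.arr β = 0)
    {I : Ideal (PathAlgebra k V)} [I.IsTwoSided] (hI : IsAdmissible I) (x : PathAlgebra k V) :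
    D.quotientLift h0 hI (Ideal.Quotient.mk I x) = D.lift k x := rfl

end PathSystem

namespace PathAlgebra

theorem induction_generators {P : PathAlgebra k V → Prop} (zero : P 0)
    (add : ∀ x y, P x → P y → P (x + y)) (smul : ∀ (c : k) x, P x → P (c • x))
    (mul : ∀ x y, P x → P y → P (x * y)) (vertex : ∀ a, P (ofPath k ⟨a, a, .nil⟩))
    (arrow : ∀ a b (α : a ⟶ b), P (ofPath k ⟨a, b, α.toPath⟩)) (x : PathAlgebra k V) : P x := by
  induction x using PathAlgebra.induction_on with
  | zero => exact zero
  | add x y hx hy => exact add x y hx hy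
  | smul c p =>
    refine smul c _ ?_
    obtain ⟨a, b, p⟩ := p
    induction p with
    | nil => exact vertex a
    | cons p α ih =>
      have := mul _ _ ih (arrow _ _ α)
      rwa [ofPath_mul_ofPath, pathMul_comp] at this

/-- Homomorphisms from a path algebra agree if they agree on trivial paths and arrows. -/
theorem algHom_ext {f g : PathAlgebra k V →ₐ[k] E}
    (hv : ∀ a, f (ofPath k ⟨a, a, .nil⟩) = g (ofPath k ⟨a, a, .nil⟩))
    (ha : ∀ a b (α : a ⟶ b), f (ofPath k ⟨a, b, α.toPath⟩) = g (ofPath k ⟨a, b, α.toPath⟩)) :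
    f = g := by
  refine AlgHom.ext fun x => ?_
  induction x using induction_generators with
  | zero => simp
  | add x y hx hy => simp [hx, hy]
  | smul c x hx => simp [hx]
  | mul x y hx hy => simp [hx, hy]
  | vertex a => exact hv a
  | arrow a b α => exact ha a b α

theorem commute_of_generators (f : PathAlgebra k V →ₐ[k] E) (y : E)
    (hv : ∀ a, Commute (f (ofPath k ⟨a, a, .nil⟩)) y)
    (ha : ∀ a b (α : a ⟶ b), Commute (f (ofPath k ⟨a, b, α.toPath⟩)) y) (x : PathAlgebra k V) :
    Commute (f x) y := by
  induction x using induction_generators with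
  | zero => simp
  | add x z hx hz => simpa using hx.add_left hz
  | smul c x hx => simpa using hx.smul_left c
  | mul x z hx hz => simpa using hx.mul_left hz
  | vertex a => exact hv a
  | arrow a b α => exact ha a b α

end PathAlgebra

/-- Commuting systems of elements with vanishing products of arrows commute. -/
theorem PathSystem.commute_lift {W : Type*} [Quiver W] [Fintype W] (D : PathSystem V E)
    (D' : PathSystem W E) (hvv : ∀ a b, Commute (D.idem a) (D'.idem b))
    (hva : ∀ a {b c} (β : b ⟶ c), Commute (D.idem a) (D'.arr β))
    (hav : ∀ a {b c} (α : b ⟶ c), Commute (D.arr α) (D'.idem a))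
    (haa : ∀ {a b c d} (α : a ⟶ b) (β : c ⟶ d), Commute (D.arr α) (D'.arr β))
    (x : PathAlgebra k V) (y : PathAlgebra k W) : Commute (D.lift k x) (D'.lift k y) := by
  refine commute_of_generators _ _ (fun a => ?_) (fun a b α => ?_) x <;>
    refine (commute_of_generators _ _ (fun c => ?_) (fun c d β => ?_) y).symm
  · rw [lift_vertex, lift_vertex]; exact (hvv a c).symm
  · rw [lift_vertex, lift_arrow]; exact (hva a β).symm
  · rw [lift_vertex, lift_arrow]; exact (hav c α).symm
  · rw [lift_arrow, lift_arrow]; exact (haa α β).symm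

end BoundQuiver

/-! ### Separated representations of the product quiver -/

namespace BoundQuiver

open PathAlgebra Matrix

/-- The arrows of the product of two quivers: an arrow of one paired with a vertex of the other. -/
abbrev ProdArrow (V W : Type*) [Quiver V] [Quiver W] :=
  ((Σ a b : V, a ⟶ b) × W) ⊕ (V × (Σ a b : W, a ⟶ b))

namespace ProdArrow

variable {V W : Type*} [Quiver V] [Quiver W]

/-- The source of an arrow of the product quiver. -/
def src : ProdArrow V W → V × W :=
  Sum.elim (fun p => (p.1.1, p.2)) fun p => (p.1, p.2.1)

/-- The target of an arrow of the product quiver. -/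
def tgt : ProdArrow V W → V × W :=
  Sum.elim (fun p => (p.1.2.1, p.2)) fun p => (p.1, p.2.2.1)

end ProdArrow

/-- A representation of the product quiver on `X ⊕ Y`, where `X = k^ι` and `Y = k^κ` are graded by
the vertices and every arrow maps `X` to `Y` (from its target to its source) and `Y` to `0`. -/
structure SeparatedRep (k V W ι κ : Type*) [Field k] [Quiver V] [Quiver W] where
  degX : ι → V × W
  degY : κ → V × W
  mat : ProdArrow V W → Matrix κ ι k
  degX_eq : ∀ {p t s}, mat p t s ≠ 0 → degX s = p.tgt
  degY_eq : ∀ {p t s}, mat p t s ≠ 0 → degY t = p.src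

namespace SeparatedRep

section Proj

variable {k V W ι κ : Type*} [Field k] [Quiver V] [Quiver W] [Fintype ι] [Fintype κ]
  [DecidableEq ι] [DecidableEq κ] (S : SeparatedRep k V W ι κ)

open Classical in
/-- The projection onto the part of `X ⊕ Y` whose degree satisfies a predicate. -/
noncomputable def proj (P : V × W → Prop) : Matrix (ι ⊕ κ) (ι ⊕ κ) k :=
  fromBlocks (diagonal fun i => if P (S.degX i) then 1 else 0) 0 0
    (diagonal fun i => if P (S.degY i) then 1 else 0)

theorem proj_mul_proj (P Q : V × W → Prop) :
    S.proj P * S.proj Q = S.proj fun x => P x ∧ Q x := by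
  simp only [proj, fromBlocks_multiply, diagonal_mul_diagonal, Matrix.mul_zero, Matrix.zero_mul,
    add_zero, zero_add, ite_mul, one_mul, zero_mul]
  congr 2 <;> ext i <;> split_ifs <;> simp_all

-- The rows supporting `S.mat q` have degree `q.src`, so projecting on the left keeps or kills each
-- summand as a whole.
open Classical in
theorem proj_mul_lower (P : V × W → Prop) {J : Type*} [Fintype J] (p : J → ProdArrow V W) :
    S.proj P * fromBlocks 0 0 (∑ j, S.mat (p j)) 0 =
      fromBlocks 0 0 (∑ j, if P (p j).src then S.mat (p j) else 0) 0 := by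
  simp only [proj, fromBlocks_multiply, Matrix.mul_zero, Matrix.zero_mul, add_zero, zero_add]
  congr 1
  ext t s
  simp only [diagonal_mul, Matrix.sum_apply, Finset.mul_sum]
  refine Finset.sum_congr rfl fun j _ => ?_
  by_cases h : S.mat (p j) t s = 0
  · split_ifs <;> simp [h]
  · rw [S.degY_eq h]
    split_ifs <;> simp

open Classical in
theorem lower_mul_proj (P : V × W → Prop) {J : Type*} [Fintype J] (p : J → ProdArrow V W) :
    fromBlocks 0 0 (∑ j, S.mat (p j)) 0 * S.proj P =
      fromBlocks 0 0 (∑ j, if P (p j).tgt then S.mat (p j) else 0) 0 := by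
  simp only [proj, fromBlocks_multiply, Matrix.mul_zero, Matrix.zero_mul, add_zero]
  congr 1
  ext t s
  simp only [mul_diagonal, Matrix.sum_apply, Finset.sum_mul]
  refine Finset.sum_congr rfl fun j _ => ?_
  by_cases h : S.mat (p j) t s = 0
  · split_ifs <;> simp [h]
  · rw [S.degX_eq h]
    split_ifs <;> simp

end Proj

theorem lower_mul_lower {k ι κ : Type*} [Field k] [Fintype ι] [Fintype κ] (N N' : Matrix κ ι k) :
    (fromBlocks 0 0 N 0 * fromBlocks 0 0 N' 0 : Matrix (ι ⊕ κ) (ι ⊕ κ) k) = 0 := by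
  simp [fromBlocks_multiply]

variable {k V W ι κ : Type*} [Field k] [Quiver V] [Quiver W] [Fintype V] [Fintype W]
  [Fintype ι] [Fintype κ] [DecidableEq ι] [DecidableEq κ] (S : SeparatedRep k V W ι κ)

open Classical in
/-- The action of the path algebra of the first quiver. -/
noncomputable def systemLeft : PathSystem V (Matrix (ι ⊕ κ) (ι ⊕ κ) k) where
  idem a := S.proj fun x => x.1 = a
  arr {a b} α := fromBlocks 0 0 (∑ w, S.mat (.inl (⟨a, b, α⟩, w))) 0
  idem_mul_self a := by simp only [proj_mul_proj, and_self]
  idem_mul_ne a b h := by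
    rw [proj_mul_proj, ← show (S.proj fun _ => False) = 0 by simp [proj]]
    congr 1
    ext x
    exact iff_false_intro fun hx => h (hx.1.symm.trans hx.2)
  sum_idem := by
    ext (i | i) (j | j) <;>
      simp [proj, Matrix.sum_apply, diagonal_apply, one_apply]
  idem_mul_arr {a b} α := by simp [proj_mul_lower, ProdArrow.src]
  arr_mul_idem {a b} α := by simp [lower_mul_proj, ProdArrow.tgt]

open Classical in
/-- The action of the path algebra of the second quiver. -/
noncomputable def systemRight : PathSystem W (Matrix (ι ⊕ κ) (ι ⊕ κ) k) where
  idem a := S.proj fun x => x.2 = a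
  arr {a b} α := fromBlocks 0 0 (∑ v, S.mat (.inr (v, ⟨a, b, α⟩))) 0
  idem_mul_self a := by simp only [proj_mul_proj, and_self]
  idem_mul_ne a b h := by
    rw [proj_mul_proj, ← show (S.proj fun _ => False) = 0 by simp [proj]]
    congr 1
    ext x
    exact iff_false_intro fun hx => h (hx.1.symm.trans hx.2)
  sum_idem := by
    ext (i | i) (j | j) <;>
      simp [proj, Matrix.sum_apply, diagonal_apply, one_apply]
  idem_mul_arr {a b} α := by simp [proj_mul_lower, ProdArrow.src]
  arr_mul_idem {a b} α := by simp [lower_mul_proj, ProdArrow.tgt]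

theorem systemLeft_arr_mul_arr {a b c : V} (α : a ⟶ b) (β : b ⟶ c) :
    S.systemLeft.arr α * S.systemLeft.arr β = 0 := lower_mul_lower _ _

theorem systemRight_arr_mul_arr {a b c : W} (α : a ⟶ b) (β : b ⟶ c) :
    S.systemRight.arr α * S.systemRight.arr β = 0 := lower_mul_lower _ _

theorem commute_lift (x : PathAlgebra k V) (y : PathAlgebra k W) :
    Commute (S.systemLeft.lift k x) (S.systemRight.lift k y) := by
  refine PathSystem.commute_lift _ _ (fun a b => ?_) (fun a b c β => ?_) (fun a b c α => ?_)
    (fun α β => ?_) x y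
  · simp only [commute_iff_eq, systemLeft, systemRight, proj_mul_proj, and_comm]
  · simp only [commute_iff_eq, systemLeft, systemRight, proj_mul_lower, lower_mul_proj]
    -- An arrow of the second quiver at the vertex `v` of the first has first coordinate `v` at both
    -- ends, so both products select the same summands.
    rfl
  · simp only [commute_iff_eq, systemLeft, systemRight, proj_mul_lower, lower_mul_proj]
    rfl
  · exact (lower_mul_lower _ _).trans (lower_mul_lower _ _).symm

variable {I : Ideal (PathAlgebra k V)} [I.IsTwoSided] (hI : IsAdmissible I)
  {J : Ideal (PathAlgebra k W)} [J.IsTwoSided] (hJ : IsAdmissible J)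

/-- The action of the tensor product of bound quiver algebras on a separated representation. -/
noncomputable def action :
    ((PathAlgebra k V ⧸ I) ⊗[k] (PathAlgebra k W ⧸ J)) →ₐ[k] Matrix (ι ⊕ κ) (ι ⊕ κ) k :=
  Algebra.TensorProduct.lift (S.systemLeft.quotientLift S.systemLeft_arr_mul_arr hI)
    (S.systemRight.quotientLift S.systemRight_arr_mul_arr hJ) fun x y => by
      obtain ⟨x, rfl⟩ := Ideal.Quotient.mk_surjective x
      obtain ⟨y, rfl⟩ := Ideal.Quotient.mk_surjective y
      exact S.commute_lift x y

/-- The element of the tensor product of path algebras given by an arrow of the product quiver. -/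
noncomputable def arrowElement (I : Ideal (PathAlgebra k V)) [I.IsTwoSided]
    (J : Ideal (PathAlgebra k W)) [J.IsTwoSided] :
    ProdArrow V W → (PathAlgebra k V ⧸ I) ⊗[k] (PathAlgebra k W ⧸ J)
  | .inl (⟨a, b, α⟩, w) => Ideal.Quotient.mk I (ofPath k ⟨a, b, α.toPath⟩) ⊗ₜ
      Ideal.Quotient.mk J (ofPath k ⟨w, w, .nil⟩)
  | .inr (v, ⟨a, b, β⟩) => Ideal.Quotient.mk I (ofPath k ⟨v, v, .nil⟩) ⊗ₜ
      Ideal.Quotient.mk J (ofPath k ⟨a, b, β.toPath⟩)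

/-- The vertex idempotent of the other factor cuts one summand out of the sum by which an arrow
acts. Hence an intertwiner must respect each edge of the product quiver separately. -/
theorem action_arrowElement (p : ProdArrow V W) :
    S.action hI hJ (arrowElement I J p) = fromBlocks 0 0 (S.mat p) 0 := by
  rcases p with ⟨⟨a, b, α⟩, w⟩ | ⟨v, ⟨a, b, β⟩⟩
  · rw [arrowElement, action, Algebra.TensorProduct.lift_tmul, PathSystem.quotientLift_mk,
      PathSystem.quotientLift_mk, PathSystem.lift_arrow, PathSystem.lift_vertex]
    simp only [systemLeft, systemRight, lower_mul_proj, ProdArrow.tgt, Sum.elim_inl]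
    congr 1
    exact (Finset.sum_eq_single w (fun b _ hb => if_neg hb) (by simp)).trans (if_pos rfl)
  · rw [arrowElement, action, Algebra.TensorProduct.lift_tmul, PathSystem.quotientLift_mk,
      PathSystem.quotientLift_mk, PathSystem.lift_arrow, PathSystem.lift_vertex]
    simp only [systemLeft, systemRight, proj_mul_lower, ProdArrow.src, Sum.elim_inr]
    congr 1
    exact (Finset.sum_eq_single v (fun b _ hb => if_neg hb) (by simp)).trans (if_pos rfl)

end SeparatedRep

/-! ### Rigid families and their intertwiners -/

/-- A one-parameter family of representations of bipartite shape, with edges indexed by `J`, is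
rigid if it is faithful and its homomorphisms are scalars, nonzero only for equal parameters. -/
def RigidFamily {k J ι κ : Type*} [Field k] [Fintype ι] [Fintype κ] [DecidableEq ι] [DecidableEq κ]
    (N : k → J → Matrix κ ι k) : Prop :=
  (∀ l m (B : Matrix ι κ k), (∀ j, B * N l j = 0) → (∀ j, N m j * B = 0) → B = 0) ∧
  ∀ l m (A : Matrix ι ι k) (D : Matrix κ κ k), (∀ j, D * N l j = N m j * A) →
    ∃ s : k, (s = 0 ∨ l = m) ∧ A = scalar ι s ∧ D = scalar κ s

/-- Transposition exchanges the two sides of the shape and the two parameters; it supplies the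
shapes with all arrows reversed. -/
theorem RigidFamily.transpose {k J ι κ : Type*} [Field k] [Fintype ι] [Fintype κ] [DecidableEq ι]
    [DecidableEq κ] {N : k → J → Matrix κ ι k} (h : RigidFamily N) :
    RigidFamily fun l j => (N l j)ᵀ := by
  refine ⟨fun l m B h1 h2 => ?_, fun l m A D hAD => ?_⟩
  · have := h.1 m l Bᵀ (fun j => by simpa using congrArg Matrix.transpose (h2 j))
      (fun j => by simpa using congrArg Matrix.transpose (h1 j))
    simpa using congrArg Matrix.transpose this
  · obtain ⟨s, hs, hA, hD⟩ := h.2 m l Dᵀ Aᵀ (fun j => by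
      simpa using congrArg Matrix.transpose (hAD j).symm)
    exact ⟨s, hs.imp_right Eq.symm, by simpa using congrArg Matrix.transpose hD,
      by simpa using congrArg Matrix.transpose hA⟩

universe u₁ u₂ u₃ u₄ u₅

/-- A rigid family of bipartite shape, placed along distinct arrows of the product quiver, makes
the tensor product of two bound quiver algebras representation-infinite. -/
theorem representationInfinite_of_rigidFamily {k : Type u₁} [Field k] [Infinite k]
    {V : Type u₂} {W : Type u₃} [Quiver.{u₄} V] [Quiver.{u₅} W] [Fintype V] [Fintype W]
    {I : Ideal (PathAlgebra k V)} [I.IsTwoSided] (hI : IsAdmissible I)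
    {J : Ideal (PathAlgebra k W)} [J.IsTwoSided] (hJ : IsAdmissible J)
    {E ι κ : Type} [Fintype ι] [Fintype κ] [DecidableEq ι] [DecidableEq κ] [Nonempty ι]
    {N : k → E → Matrix κ ι k} (hN : RigidFamily N)
    (p : E → ProdArrow V W) (hp : Function.Injective p) (degX : ι → V × W) (degY : κ → V × W)
    (hdeg : ∀ l j t s, N l j t s ≠ 0 → degX s = (p j).tgt ∧ degY t = (p j).src) :
    RepresentationInfinite ((PathAlgebra k V ⧸ I) ⊗[k] (PathAlgebra k W ⧸ J)) := by
  have key : ∀ l q t s, Function.extend p (N l) 0 q t s ≠ 0 →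
      degX s = q.tgt ∧ degY t = q.src := by
    intro l q t s h
    by_cases hq : ∃ j, p j = q
    · obtain ⟨j, rfl⟩ := hq
      rw [hp.extend_apply] at h
      exact hdeg l j t s h
    · rw [Function.extend_apply' _ _ _ hq] at h
      exact absurd rfl h
  let S : k → SeparatedRep k V W ι κ := fun l =>
    ⟨degX, degY, Function.extend p (N l) 0, fun h => (key l _ _ _ h).1, fun h => (key l _ _ _ h).2⟩
  refine representationInfinite_of_matrix_family.{max u₂ u₃ u₄ u₅, u₁}
    (fun l => (S l).action hI hJ) fun l m Φ hΦ => ?_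
  have hΦ' : ∀ j, Φ * fromBlocks 0 0 (N l j) 0 = fromBlocks 0 0 (N m j) 0 * Φ := by
    intro j
    have := hΦ (SeparatedRep.arrowElement I J (p j))
    rw [SeparatedRep.action_arrowElement, SeparatedRep.action_arrowElement] at this
    simpa only [S, hp.extend_apply] using this
  obtain ⟨A, B, C, D, rfl⟩ : ∃ A B C D, Φ = fromBlocks A B C D :=
    ⟨_, _, _, _, (fromBlocks_toBlocks Φ).symm⟩
  simp only [fromBlocks_multiply, fromBlocks_inj, Matrix.mul_zero, Matrix.zero_mul, add_zero,
    zero_add] at hΦ'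
  have hB : B = 0 := hN.1 l m B (fun j => (hΦ' j).1) fun j => (hΦ' j).2.2.2.symm
  -- `A` and `D` are not assumed to respect the grading. Vertices of the shape may thus coincide in
  -- `V × W`, for example because of loops; only the arrows have to be distinct.
  obtain ⟨s, hs, rfl, rfl⟩ := hN.2 l m A D fun j => (hΦ' j).2.2.1
  refine ⟨s, hs, ?_⟩
  have : fromBlocks (scalar ι s) B C (scalar κ s) - scalar (ι ⊕ κ) s = fromBlocks 0 0 C 0 := by
    subst hB
    ext (i | i) (j | j) <;> simp [diagonal_apply]
  rw [this]
  exact SeparatedRep.lower_mul_lower _ _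

end BoundQuiver

/-! ### The Euclidean shapes D̃₄, D̃₅ and Ẽ₆ -/

namespace BoundQuiver
open Matrix

/-- Four lines in a plane, with cross ratio `l`: the shape is a star with four edges. -/
def fourSubspaces {k : Type*} [Field k] (l : k) : Fin 4 → Matrix (Fin 2) (Fin 4) k :=
  ![single 0 0 1, single 1 1 1, single 0 2 1 + single 1 2 1, single 0 3 1 + single 1 3 l]

/-- A map of the plane preserving the lines of `e₀`, `e₁` and `e₀ + e₁` is a scalar `s`; the fourth
line then gives `s l = s m`. This includes the degenerate values `l = 0, 1`. -/
theorem rigidFamily_fourSubspaces {k : Type*} [Field k] :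
    RigidFamily (fourSubspaces : k → Fin 4 → Matrix (Fin 2) (Fin 4) k) := by
  refine ⟨fun l m B h h' => ?_, fun l m A D h => ?_⟩
  · have e : ∀ j t s, (B * fourSubspaces l j) t s = 0 := fun j t s => by rw [h]; rfl
    simp [fourSubspaces, Fin.forall_fin_succ, Matrix.mul_add, -mul_eq_zero,
      -zero_eq_mul] at e
    ext i j
    fin_cases i <;> fin_cases j <;> simp <;> grind
  · have e : ∀ j t s, (D * fourSubspaces l j) t s = (fourSubspaces m j * A) t s := fun j t s => by
      rw [h]
    simp [fourSubspaces, Fin.forall_fin_succ, Matrix.mul_add, Matrix.add_mul, -mul_eq_zero,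
      -zero_eq_mul] at e
    refine ⟨A 0 0, ?_, ?_, ?_⟩
    · grind
    · ext i j
      fin_cases i <;> fin_cases j <;> simp <;> grind
    · ext i j
      fin_cases i <;> fin_cases j <;> simp <;> grind

/-- Two lines in the target and two functionals on the source of an isomorphism of planes: the
shape consists of two stars with three edges which share one edge. -/
def twoStars {k : Type*} [Field k] (l : k) : Fin 5 → Matrix (Fin 4) (Fin 4) k :=
  ![single 0 0 1 + single 1 1 1, single 2 0 1, single 3 1 1, single 0 2 1 + single 1 2 1,
    single 0 3 1 + single 1 3 l]

/-- Edge `0` identifies the maps on the two planes, the two coordinate functionals make them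
diagonal, the line of `e₀ + e₁` makes them scalar, and the last line compares the parameters. -/
theorem rigidFamily_twoStars {k : Type*} [Field k] :
    RigidFamily (twoStars : k → Fin 5 → Matrix (Fin 4) (Fin 4) k) := by
  refine ⟨fun l m B h h' => ?_, fun l m A D h => ?_⟩
  · have e : ∀ j t s, (B * twoStars l j) t s = 0 := fun j t s => by rw [h]; rfl
    simp [twoStars, Fin.forall_fin_succ, Matrix.mul_add, -mul_eq_zero,
      -zero_eq_mul] at e
    ext i j
    fin_cases i <;> fin_cases j <;> simp <;> grind
  · have e : ∀ j t s, (D * twoStars l j) t s = (twoStars m j * A) t s := fun j t s => by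
      rw [h]
    simp [twoStars, Fin.forall_fin_succ, Matrix.mul_add, Matrix.add_mul, -mul_eq_zero,
      -zero_eq_mul] at e
    refine ⟨A 0 0, ?_, ?_, ?_⟩
    · grind
    · ext i j
      fin_cases i <;> fin_cases j <;> simp <;> grind
    · ext i j
      fin_cases i <;> fin_cases j <;> simp <;> grind

/-- Three flags in a three-dimensional space, with triple ratio `l`: the shape is a star with three
arms of length two. -/
def threeFlags {k : Type*} [Field k] (l : k) : Fin 6 → Matrix (Fin 6) (Fin 6) k :=
  ![single 1 0 1 + single 2 1 1, single 0 2 1 + single 2 3 1, single 0 4 1 + single 1 5 1,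
    single 3 0 1 + single 3 1 1, single 4 2 1 + single 4 3 1, single 5 4 1 + single 5 5 l]

-- The planes of the flags are the coordinate planes of `k³`, so a map preserving them is diagonal.
-- The lines are the kernels of functionals on these planes: the first two functionals equate the
-- diagonal entries, the third gives `s l = s m`.
set_option maxHeartbeats 2000000 in
theorem rigidFamily_threeFlags {k : Type*} [Field k] :
    RigidFamily (threeFlags : k → Fin 6 → Matrix (Fin 6) (Fin 6) k) := by
  refine ⟨fun l m B h h' => ?_, fun l m A D h => ?_⟩
  · have e : ∀ j t s, (B * threeFlags l j) t s = 0 := fun j t s => by rw [h]; rfl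
    simp [threeFlags, Fin.forall_fin_succ, Matrix.mul_add, -mul_eq_zero,
      -zero_eq_mul] at e
    ext i j
    fin_cases i <;> fin_cases j <;> simp [e]
  · have e : ∀ j t s, (D * threeFlags l j) t s = (threeFlags m j * A) t s := fun j t s => by
      rw [h]
    simp [threeFlags, Fin.forall_fin_succ, Matrix.mul_add, Matrix.add_mul,
      -mul_eq_zero, -zero_eq_mul] at e
    refine ⟨A 0 0, ?_, ?_, ?_⟩
    · grind
    · have : ∀ i j, A i j = scalar (Fin 6) (A 0 0) i j := by
        simp [Fin.forall_fin_succ]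
        grind
      exact Matrix.ext this
    · have : ∀ i j, D i j = scalar (Fin 6) (A 0 0) i j := by
        simp [Fin.forall_fin_succ]
        grind
      exact Matrix.ext this

variable {k : Type*} [Field k]

theorem fourSubspaces_support (l : k) (j : Fin 4) (t : Fin 2) (s : Fin 4)
    (h : fourSubspaces l j t s ≠ 0) : s = j := by
  revert h
  fin_cases j <;> fin_cases s <;> simp [fourSubspaces]

theorem twoStars_support (l : k) (j : Fin 5) (t s : Fin 4) (h : twoStars l j t s ≠ 0) :
    (![0, 0, 1, 2] : Fin 4 → Fin 3) s = (![0, 0, 0, 1, 2] : Fin 5 → Fin 3) j ∧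
      (![0, 0, 1, 2] : Fin 4 → Fin 3) t = (![0, 1, 2, 0, 0] : Fin 5 → Fin 3) j := by
  revert h
  fin_cases j <;> fin_cases t <;> fin_cases s <;> simp [twoStars]

theorem threeFlags_support (l : k) (j t s : Fin 6) (h : threeFlags l j t s ≠ 0) :
    (![0, 0, 1, 1, 2, 2] : Fin 6 → Fin 3) s = (![0, 1, 2, 0, 1, 2] : Fin 6 → Fin 3) j ∧
      (![0, 0, 0, 1, 2, 3] : Fin 6 → Fin 4) t = (![0, 0, 0, 1, 2, 3] : Fin 6 → Fin 4) j := by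
  revert h
  fin_cases j <;> fin_cases t <;> fin_cases s <;> simp [threeFlags]

section Shapes

variable [Infinite k] {V W : Type*} [Quiver V] [Quiver W] [Fintype V] [Fintype W]
  {I : Ideal (PathAlgebra k V)} [I.IsTwoSided] (hI : IsAdmissible I)
  {J : Ideal (PathAlgebra k W)} [J.IsTwoSided] (hJ : IsAdmissible J)

include hI hJ

theorem representationInfinite_of_four_same_src (p : Fin 4 → ProdArrow V W)
    (hp : Function.Injective p) (y : V × W) (hy : ∀ j, (p j).src = y) :
    RepresentationInfinite ((PathAlgebra k V ⧸ I) ⊗[k] (PathAlgebra k W ⧸ J)) :=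
  representationInfinite_of_rigidFamily hI hJ rigidFamily_fourSubspaces p hp
    (fun j => (p j).tgt) (fun _ => y)
    fun l j t s h => ⟨by rw [fourSubspaces_support l j t s h], (hy j).symm⟩

theorem representationInfinite_of_four_same_tgt (p : Fin 4 → ProdArrow V W)
    (hp : Function.Injective p) (y : V × W) (hy : ∀ j, (p j).tgt = y) :
    RepresentationInfinite ((PathAlgebra k V ⧸ I) ⊗[k] (PathAlgebra k W ⧸ J)) :=
  representationInfinite_of_rigidFamily hI hJ rigidFamily_fourSubspaces.transpose p hp
    (fun _ => y) (fun j => (p j).src)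
    fun l j t s h => ⟨(hy j).symm, by rw [fourSubspaces_support l j s t h]⟩

theorem representationInfinite_of_twoStars (p : Fin 5 → ProdArrow V W)
    (hp : Function.Injective p) (x y : Fin 3 → V × W)
    (hx : ∀ j, (p j).tgt = x ((![0, 0, 0, 1, 2] : Fin 5 → Fin 3) j))
    (hy : ∀ j, (p j).src = y ((![0, 1, 2, 0, 0] : Fin 5 → Fin 3) j)) :
    RepresentationInfinite ((PathAlgebra k V ⧸ I) ⊗[k] (PathAlgebra k W ⧸ J)) :=
  representationInfinite_of_rigidFamily hI hJ rigidFamily_twoStars p hp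
    (fun s => x ((![0, 0, 1, 2] : Fin 4 → Fin 3) s))
    (fun t => y ((![0, 0, 1, 2] : Fin 4 → Fin 3) t))
    fun l j t s h => ⟨by rw [(twoStars_support l j t s h).1, hx],
      by rw [(twoStars_support l j t s h).2, hy]⟩

theorem representationInfinite_of_threeFlags (p : Fin 6 → ProdArrow V W)
    (hp : Function.Injective p) (x : Fin 3 → V × W) (y : Fin 4 → V × W)
    (hx : ∀ j, (p j).tgt = x ((![0, 1, 2, 0, 1, 2] : Fin 6 → Fin 3) j))
    (hy : ∀ j, (p j).src = y ((![0, 0, 0, 1, 2, 3] : Fin 6 → Fin 4) j)) :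
    RepresentationInfinite ((PathAlgebra k V ⧸ I) ⊗[k] (PathAlgebra k W ⧸ J)) :=
  representationInfinite_of_rigidFamily hI hJ rigidFamily_threeFlags p hp
    (fun s => x ((![0, 0, 1, 1, 2, 2] : Fin 6 → Fin 3) s))
    (fun t => y ((![0, 0, 0, 1, 2, 3] : Fin 6 → Fin 4) t))
    fun l j t s h => ⟨by rw [(threeFlags_support l j t s h).1, hx],
      by rw [(threeFlags_support l j t s h).2, hy]⟩

theorem representationInfinite_of_threeFlags_transpose (p : Fin 6 → ProdArrow V W)
    (hp : Function.Injective p) (x : Fin 3 → V × W) (y : Fin 4 → V × W)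
    (hx : ∀ j, (p j).src = x ((![0, 1, 2, 0, 1, 2] : Fin 6 → Fin 3) j))
    (hy : ∀ j, (p j).tgt = y ((![0, 0, 0, 1, 2, 3] : Fin 6 → Fin 4) j)) :
    RepresentationInfinite ((PathAlgebra k V ⧸ I) ⊗[k] (PathAlgebra k W ⧸ J)) :=
  representationInfinite_of_rigidFamily hI hJ rigidFamily_threeFlags.transpose p hp
    (fun t => y ((![0, 0, 0, 1, 2, 3] : Fin 6 → Fin 4) t))
    (fun s => x ((![0, 0, 1, 1, 2, 2] : Fin 6 → Fin 3) s))
    fun l j s t h => ⟨by rw [(threeFlags_support l j t s h).2, hy],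
      by rw [(threeFlags_support l j t s h).1, hx]⟩

variable {c l₀ l₁ l₂ : W} (h01 : l₀ ≠ l₁) (h02 : l₀ ≠ l₂) (h12 : l₁ ≠ l₂)

include h01 h02 h12

/-- The three arrows in the copy of `W` over `b` and the copy of `α` over `c` all end at `(b, c)`,
which gives D̃₄. -/
theorem representationInfinite_of_three_in {a b : V} (α : a ⟶ b)
    (β₀ : l₀ ⟶ c) (β₁ : l₁ ⟶ c) (β₂ : l₂ ⟶ c) :
    RepresentationInfinite ((PathAlgebra k V ⧸ I) ⊗[k] (PathAlgebra k W ⧸ J)) := by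
  refine representationInfinite_of_four_same_tgt hI hJ ![.inr (b, ⟨_, _, β₀⟩), .inr (b, ⟨_, _, β₁⟩),
    .inr (b, ⟨_, _, β₂⟩), .inl (⟨_, _, α⟩, c)] ?_ (b, c) ?_
  · intro i j
    fin_cases i <;> fin_cases j <;> simp <;> grind
  · intro j
    fin_cases j <;> rfl

theorem representationInfinite_of_three_out {a b : V} (α : a ⟶ b)
    (β₀ : c ⟶ l₀) (β₁ : c ⟶ l₁) (β₂ : c ⟶ l₂) :
    RepresentationInfinite ((PathAlgebra k V ⧸ I) ⊗[k] (PathAlgebra k W ⧸ J)) := by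
  refine representationInfinite_of_four_same_src hI hJ ![.inr (a, ⟨_, _, β₀⟩), .inr (a, ⟨_, _, β₁⟩),
    .inr (a, ⟨_, _, β₂⟩), .inl (⟨_, _, α⟩, c)] ?_ (a, c) ?_
  · intro i j
    fin_cases i <;> fin_cases j <;> simp <;> grind
  · intro j
    fin_cases j <;> rfl

end Shapes

end BoundQuiver

/-! ### Connected quivers without adjacent arrows -/

namespace BoundQuiver
open PathAlgebra

/-- Two arrows of a quiver (possibly the same loop) form a path of length two. -/
def HasComposableArrows (V : Type*) [Quiver V] : Prop :=
  ∃ (a b c : V), Nonempty (a ⟶ b) ∧ Nonempty (b ⟶ c)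

/-- Two distinct arrows of a quiver have the same target. -/
def HasArrowsSameTarget (V : Type*) [Quiver V] : Prop :=
  ∃ (a a' b : V) (α : a ⟶ b) (α' : a' ⟶ b),
    (⟨a, b, α⟩ : Σ a b : V, a ⟶ b) ≠ ⟨a', b, α'⟩

/-- Two distinct arrows of a quiver have the same source. -/
def HasArrowsSameSource (V : Type*) [Quiver V] : Prop :=
  ∃ (a b b' : V) (α : a ⟶ b) (α' : a ⟶ b'),
    (⟨a, b, α⟩ : Σ a b : V, a ⟶ b) ≠ ⟨a, b', α'⟩

variable {k V : Type*} [Field k] [Quiver V]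

theorem isSimpleRing_of_ringEquiv {R S : Type*} [Ring R] [Ring S] (e : R ≃+* S) [IsSimpleRing S] :
    IsSimpleRing R :=
  ⟨(RingEquiv.mapTwoSidedIdeal e).isSimpleOrder_iff.mpr inferInstance⟩

theorem ofPath_nil_mul_self (a : V) :
    ofPath k ⟨a, a, .nil⟩ * ofPath k ⟨a, a, .nil⟩ = ofPath k (⟨a, a, .nil⟩ : TotalPath V) := by
  rw [ofPath_mul_ofPath, pathMul_comp, Quiver.Path.nil_comp]

theorem ofPath_nil_mul_ne {a b : V} (h : a ≠ b) :
    ofPath k (⟨a, a, .nil⟩ : TotalPath V) * ofPath k ⟨b, b, .nil⟩ = 0 := by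
  rw [ofPath_mul_ofPath, pathMul_ne k (by exact h)]

theorem ofPath_nil_mul {a b : V} (p : Quiver.Path a b) :
    ofPath k ⟨a, a, .nil⟩ * ofPath k ⟨a, b, p⟩ = ofPath k (⟨a, b, p⟩ : TotalPath V) := by
  rw [ofPath_mul_ofPath, pathMul_comp, Quiver.Path.nil_comp]

theorem ofPath_mul_nil {a b : V} (p : Quiver.Path a b) :
    ofPath k ⟨a, b, p⟩ * ofPath k ⟨b, b, .nil⟩ = ofPath k (⟨a, b, p⟩ : TotalPath V) := by
  rw [ofPath_mul_ofPath, pathMul_comp, Quiver.Path.comp_nil]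

variable [Fintype V]

/-- The path algebra is spanned by its unit, so the quotient is `k`; it is nonzero because an
admissible ideal avoids the trivial path. -/
theorem isSimpleRing_quotient_of_unique (I : Ideal (PathAlgebra k V)) [I.IsTwoSided]
    (hI : IsAdmissible I) (a : V) (ha : ∀ b, b = a) (harr : ∀ b c : V, IsEmpty (b ⟶ c)) :
    IsSimpleRing (PathAlgebra k V ⧸ I) := by
  have : Unique V := ⟨⟨a⟩, ha⟩
  let D : PathSystem V k :=
    { idem := fun _ => 1
      arr := fun {b c} α => ((harr b c).false α).elim
      idem_mul_self := fun _ => one_mul 1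
      idem_mul_ne := fun b c h => (h ((ha b).trans (ha c).symm)).elim
      sum_idem := by simp
      idem_mul_arr := fun {b c} α => ((harr b c).false α).elim
      arr_mul_idem := fun {b c} α => ((harr b c).false α).elim }
  let f := D.quotientLift (fun {b c _} α => ((harr b c).false α).elim) hI
  have hone : (1 : PathAlgebra k V) = ofPath k ⟨a, a, .nil⟩ := by
    rw [one_def, Fintype.sum_unique, ha default]
  let e : (PathAlgebra k V ⧸ I) ≃ₐ[k] k := AlgEquiv.ofAlgHom f (Algebra.ofId k _)
    (Subsingleton.elim _ _) (by
      refine Ideal.Quotient.algHom_ext _ (algHom_ext (fun b => ?_) fun b c α => ?_)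
      · obtain rfl := ha b
        simp [← hone]
      · exact ((harr b c).false α).elim)
  exact isSimpleRing_of_ringEquiv e.toRingEquiv

theorem sum_A2Vertex {M : Type*} [AddCommMonoid M] (f : A2Vertex → M) :
    ∑ x, f x = f .one + f .two := by
  change Multiset.sum (Multiset.map f ([A2Vertex.one, A2Vertex.two] : List A2Vertex)) = _
  simp

theorem nonempty_algEquiv_A2 (I : Ideal (PathAlgebra k V)) [I.IsTwoSided]
    (hI : IsAdmissible I) {a b : V} (hab : a ≠ b) (α : a ⟶ b) (hv : ∀ c, c = a ∨ c = b)
    (harr : ∀ q : Σ a b : V, a ⟶ b, q = ⟨a, b, α⟩) :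
    Nonempty ((PathAlgebra k V ⧸ I) ≃ₐ[k] PathAlgebra k A2Vertex) := by
  classical
  let π := Ideal.Quotient.mkₐ k I
  have elim : ∀ {P : ∀ c d : V, (c ⟶ d) → Prop}, P a b α → ∀ c d β, P c d β := by
    intro P h c d β
    have := harr ⟨c, d, β⟩
    cases this
    exact h
  have hne : A2Vertex.one ≠ A2Vertex.two := by simp
  let D : PathSystem V (PathAlgebra k A2Vertex) :=
    { idem := fun c => if c = a then ofPath k ⟨.one, .one, .nil⟩ else ofPath k ⟨.two, .two, .nil⟩
      arr := fun {_ _} _ => ofPath k ⟨.one, .two, Quiver.Hom.toPath A2Arrow.arrow⟩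
      idem_mul_self := fun c => by split_ifs <;> exact ofPath_nil_mul_self _
      idem_mul_ne := fun c d h => by
        rcases hv c with rfl | rfl <;> rcases hv d with rfl | rfl
        · exact absurd rfl h
        · rw [if_pos rfl, if_neg h.symm, ofPath_nil_mul_ne hne]
        · rw [if_pos rfl, if_neg h, ofPath_nil_mul_ne hne.symm]
        · exact absurd rfl h
      sum_idem := by
        have : (Finset.univ : Finset V) = {a, b} := by
          ext c
          simpa using hv c
        rw [this, Finset.sum_pair hab, if_pos rfl, if_neg hab.symm, one_def, sum_A2Vertex]
      idem_mul_arr := fun {c d} β => elim (P := fun c d β => (if c = a then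
          ofPath k (⟨.one, .one, .nil⟩ : TotalPath A2Vertex) else ofPath k ⟨.two, .two, .nil⟩) *
            ofPath k ⟨.one, .two, Quiver.Hom.toPath A2Arrow.arrow⟩ = _)
          (by rw [if_pos rfl, ofPath_nil_mul]) c d β
      arr_mul_idem := fun {c d} β => elim (P := fun c d β =>
            ofPath k ⟨.one, .two, Quiver.Hom.toPath A2Arrow.arrow⟩ * (if d = a then
          ofPath k (⟨.one, .one, .nil⟩ : TotalPath A2Vertex) else ofPath k ⟨.two, .two, .nil⟩)
             = _)
          (by rw [if_neg hab.symm, ofPath_mul_nil]) c d β }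
  let D' : PathSystem A2Vertex (PathAlgebra k V ⧸ I) :=
    { idem := fun x => match x with
        | .one => π (ofPath k ⟨a, a, .nil⟩)
        | .two => π (ofPath k ⟨b, b, .nil⟩)
      arr := fun {_ _} _ => π (ofPath k ⟨a, b, α.toPath⟩)
      idem_mul_self := fun x => by
        cases x <;> simp only [← map_mul, ofPath_nil_mul_self]
      idem_mul_ne := fun x y h => by
        cases x <;> cases y <;>
          first | exact absurd rfl h | simp only [← map_mul, ofPath_nil_mul_ne hab,
            ofPath_nil_mul_ne hab.symm, map_zero]
      sum_idem := by
        have : (Finset.univ : Finset V) = {a, b} := by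
          ext c
          simpa using hv c
        rw [sum_A2Vertex, ← map_add, ← map_one π, one_def, this, Finset.sum_pair hab]
      idem_mul_arr := fun {x y} β => by
        change A2Arrow x y at β
        cases β
        simp only [← map_mul, ofPath_nil_mul]
      arr_mul_idem := fun {x y} β => by
        change A2Arrow x y at β
        cases β
        simp only [← map_mul, ofPath_mul_nil] }
  -- The arrow of `1 → 2` cannot follow itself. So the map descends to the quotient by `I`, and `I =
  -- 0` need not be shown first.
  have h0 : ∀ {c d e : V} (β : c ⟶ d) (γ : d ⟶ e), D.arr β * D.arr γ = 0 := by
    intro c d e β γ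
    change ofPath k _ * ofPath k _ = _
    rw [ofPath_mul_ofPath, pathMul_ne k (by simp)]
  refine ⟨AlgEquiv.ofAlgHom (D.quotientLift h0 hI) (D'.lift k) ?_ ?_⟩
  · refine algHom_ext (fun x => ?_) fun x y β => ?_
    · rw [AlgHom.comp_apply, D'.lift_vertex, AlgHom.id_apply]
      cases x
      · exact (D.lift_vertex a).trans (if_pos rfl)
      · exact (D.lift_vertex b).trans (if_neg hab.symm)
    · rw [AlgHom.comp_apply, D'.lift_arrow, AlgHom.id_apply]
      change A2Arrow x y at β
      cases β
      exact D.lift_arrow α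
  · refine Ideal.Quotient.algHom_ext _ (algHom_ext (fun c => ?_) fun c d β => ?_)
    · change D'.lift k (D.lift k _) = π _
      rw [D.lift_vertex]
      rcases hv c with rfl | rfl
      · exact (congrArg _ (if_pos rfl)).trans (D'.lift_vertex .one)
      · exact (congrArg _ (if_neg hab.symm)).trans (D'.lift_vertex .two)
    · change D'.lift k (D.lift k _) = π _
      rw [D.lift_arrow]
      refine elim (P := fun c d β => D'.lift k (D.arr β) = π (ofPath k ⟨c, d, β.toPath⟩)) ?_ c d β
      exact D'.lift_arrow A2Arrow.arrow

/-- A connected bound quiver algebra which is neither simple nor `k(1 ⟶ 2)` has two adjacent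
arrows. -/
theorem hasAdjacentArrows (hV : (underlyingGraph V).Connected)
    (I : Ideal (PathAlgebra k V)) [I.IsTwoSided] (hI : IsAdmissible I)
    (hsimple : ¬ IsSimpleRing (PathAlgebra k V ⧸ I))
    (hA2 : IsEmpty ((PathAlgebra k V ⧸ I) ≃ₐ[k] PathAlgebra k A2Vertex)) :
    HasComposableArrows V ∨ HasArrowsSameTarget V ∨ HasArrowsSameSource V := by
  by_contra! h
  obtain ⟨hc, ht, hs⟩ := h
  -- By connectedness, an arrow crosses the boundary of every nonempty proper set of vertices.
  have boundary : ∀ (S : Set V) (u v : V), u ∈ S → v ∉ S →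
      ∃ x ∈ S, ∃ y ∉ S, Nonempty (x ⟶ y) ∨ Nonempty (y ⟶ x) := by
    intro S u v hu hv
    obtain ⟨w⟩ := hV.preconnected u v
    obtain ⟨d, -, h1, h2⟩ := w.exists_boundary_dart S hu hv
    exact ⟨_, h1, _, h2, ((SimpleGraph.fromRel_adj _ _ _).mp d.adj).2⟩
  by_cases hE : ∃ a b : V, Nonempty (a ⟶ b)
  · obtain ⟨a, b, ⟨α⟩⟩ := hE
    have hab : a ≠ b := by
      rintro rfl
      exact hc ⟨a, a, a, ⟨α⟩, ⟨α⟩⟩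
    have hv : ∀ c, c = a ∨ c = b := by
      intro c
      by_contra hcab
      obtain ⟨x, hx, y, hy, hxy⟩ := boundary {a, b} a c (by simp) (by simpa using hcab)
      simp only [Set.mem_insert_iff, Set.mem_singleton_iff, not_or] at hx hy
      rcases hx with rfl | rfl <;> rcases hxy with ⟨⟨β⟩⟩ | ⟨⟨β⟩⟩
      · exact hs ⟨_, _, _, α, β, fun e => hy.2 (by cases e; rfl)⟩
      · exact hc ⟨_, _, _, ⟨β⟩, ⟨α⟩⟩
      · exact hc ⟨_, _, _, ⟨α⟩, ⟨β⟩⟩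
      · exact ht ⟨_, _, _, α, β, fun e => hy.1 (by cases e; rfl)⟩
    refine hA2.false (nonempty_algEquiv_A2 I hI hab α hv ?_).some
    rintro ⟨c, d, β⟩
    by_contra hne
    rcases hv c with rfl | rfl
    · exact hs ⟨_, _, _, β, α, hne⟩
    · exact hc ⟨_, _, _, ⟨α⟩, ⟨β⟩⟩
  · obtain ⟨a⟩ := hV.nonempty
    refine hsimple (isSimpleRing_quotient_of_unique I hI a (fun b => ?_) fun b c =>
      ⟨fun α => hE ⟨b, c, ⟨α⟩⟩⟩)
    by_contra hb
    obtain ⟨x, -, y, -, ⟨⟨β⟩⟩ | ⟨⟨β⟩⟩⟩ := boundary {a} a b rfl hb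
    · exact hE ⟨_, _, ⟨β⟩⟩
    · exact hE ⟨_, _, ⟨β⟩⟩

end BoundQuiver

/-! ### Stars with both incoming and outgoing edges -/

namespace BoundQuiver

section Mixed

variable {k : Type*} [Field k] [Infinite k] {V W : Type*} [Quiver V] [Quiver W] [Fintype V]
  [Fintype W] {I : Ideal (PathAlgebra k V)} [I.IsTwoSided] (hI : IsAdmissible I)
  {J : Ideal (PathAlgebra k W)} [J.IsTwoSided] (hJ : IsAdmissible J)
  {c l₀ l₁ l₂ : W}

include hI hJ

/-- Composable arrows of `V` give Ẽ₆ centred at the target copy of `(b, c)`, a common target gives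
D̃₄ there, and a common source gives D̃₅, whose middle edge is `α` over `c`. -/
theorem representationInfinite_of_two_in_one_out
    (hV : HasComposableArrows V ∨ HasArrowsSameTarget V ∨ HasArrowsSameSource V)
    (h01 : l₀ ≠ l₁) (h0 : l₀ ≠ c) (h1 : l₁ ≠ c)
    (β₀ : l₀ ⟶ c) (β₁ : l₁ ⟶ c) (γ : c ⟶ l₂) :
    RepresentationInfinite ((PathAlgebra k V ⧸ I) ⊗[k] (PathAlgebra k W ⧸ J)) := by
  rcases hV with ⟨a, b, d, ⟨α⟩, ⟨α'⟩⟩ | ⟨a, a', b, α, α', hne⟩ | ⟨a, b, b', α, α', hne⟩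
  · refine representationInfinite_of_threeFlags_transpose hI hJ
      ![.inr (b, ⟨_, _, β₀⟩), .inr (b, ⟨_, _, β₁⟩), .inl (⟨_, _, α⟩, c), .inl (⟨_, _, α'⟩, l₀),
        .inl (⟨_, _, α'⟩, l₁), .inr (a, ⟨_, _, γ⟩)] ?_
      ![(b, l₀), (b, l₁), (a, c)] ![(b, c), (d, l₀), (d, l₁), (a, l₂)] ?_ ?_
    -- `α` and `α'` may be the same loop; their copies still differ because `l₀` and `l₁` differ
    -- from `c`.
    · intro i j
      fin_cases i <;> fin_cases j <;> simp <;> grind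
    all_goals
      intro j
      fin_cases j <;> rfl
  · refine representationInfinite_of_four_same_tgt hI hJ
      ![.inr (b, ⟨_, _, β₀⟩), .inr (b, ⟨_, _, β₁⟩), .inl (⟨_, _, α⟩, c), .inl (⟨_, _, α'⟩, c)]
      ?_ (b, c) ?_
    · intro i j
      fin_cases i <;> fin_cases j <;> simp <;> grind
    · intro j
      fin_cases j <;> rfl
  · refine representationInfinite_of_twoStars hI hJ
      ![.inl (⟨_, _, α⟩, c), .inr (b, ⟨_, _, β₀⟩), .inr (b, ⟨_, _, β₁⟩), .inl (⟨_, _, α'⟩, c),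
        .inr (a, ⟨_, _, γ⟩)] ?_ ![(b, c), (b', c), (a, l₂)] ![(a, c), (b, l₀), (b, l₁)] ?_ ?_
    · intro i j
      fin_cases i <;> fin_cases j <;> simp <;> grind
    all_goals
      intro j
      fin_cases j <;> rfl

theorem representationInfinite_of_one_in_two_out
    (hV : HasComposableArrows V ∨ HasArrowsSameTarget V ∨ HasArrowsSameSource V)
    (h12 : l₁ ≠ l₂) (h1 : l₁ ≠ c) (h2 : l₂ ≠ c)
    (β : l₀ ⟶ c) (γ₁ : c ⟶ l₁) (γ₂ : c ⟶ l₂) :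
    RepresentationInfinite ((PathAlgebra k V ⧸ I) ⊗[k] (PathAlgebra k W ⧸ J)) := by
  rcases hV with ⟨a, b, d, ⟨α⟩, ⟨α'⟩⟩ | ⟨a, a', b, α, α', hne⟩ | ⟨a, b, b', α, α', hne⟩
  · refine representationInfinite_of_threeFlags hI hJ
      ![.inr (b, ⟨_, _, γ₁⟩), .inr (b, ⟨_, _, γ₂⟩), .inl (⟨_, _, α'⟩, c), .inl (⟨_, _, α⟩, l₁),
        .inl (⟨_, _, α⟩, l₂), .inr (d, ⟨_, _, β⟩)] ?_
      ![(b, l₁), (b, l₂), (d, c)] ![(b, c), (a, l₁), (a, l₂), (d, l₀)] ?_ ?_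
    · intro i j
      fin_cases i <;> fin_cases j <;> simp <;> grind
    all_goals
      intro j
      fin_cases j <;> rfl
  · refine representationInfinite_of_twoStars hI hJ
      ![.inl (⟨_, _, α⟩, c), .inl (⟨_, _, α'⟩, c), .inr (b, ⟨_, _, β⟩), .inr (a, ⟨_, _, γ₁⟩),
        .inr (a, ⟨_, _, γ₂⟩)] ?_ ![(b, c), (a, l₁), (a, l₂)] ![(a, c), (a', c), (b, l₀)] ?_ ?_
    · intro i j
      fin_cases i <;> fin_cases j <;> simp <;> grind
    all_goals
      intro j
      fin_cases j <;> rfl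
  · refine representationInfinite_of_four_same_src hI hJ
      ![.inr (a, ⟨_, _, γ₁⟩), .inr (a, ⟨_, _, γ₂⟩), .inl (⟨_, _, α⟩, c), .inl (⟨_, _, α'⟩, c)]
      ?_ (a, c) ?_
    · intro i j
      fin_cases i <;> fin_cases j <;> simp <;> grind
    · intro j
      fin_cases j <;> rfl

end Mixed

end BoundQuiver

/-! ### The orientations of D₄ -/

open BoundQuiver in
theorem mainTheorem3
    {k : Type*} [Field k] [IsAlgClosed k]
    {V : Type*} [Quiver V] [Fintype V] [∀ a b : V, Finite (a ⟶ b)]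
    {W : Type*} [Quiver W] [Fintype W] [∀ a b : W, Finite (a ⟶ b)]
    (hV : (underlyingGraph V).Connected) (hW : (underlyingGraph W).Connected)
    (I : Ideal (PathAlgebra k V)) [I.IsTwoSided] (hI : IsAdmissible I)
    (J : Ideal (PathAlgebra k W)) [J.IsTwoSided] (hJ : IsAdmissible J)
    (hsimple : ¬ IsSimpleRing (PathAlgebra k V ⧸ I))
    (hA2 : IsEmpty ((PathAlgebra k V ⧸ I) ≃ₐ[k] PathAlgebra k A2Vertex))
    (hD4 : graphD4.IsContained (underlyingGraph W)) :
    RepresentationInfinite ((PathAlgebra k V ⧸ I) ⊗[k] (PathAlgebra k W ⧸ J)) := by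
  have : Infinite k := IsAlgClosed.instInfinite
  have hadj := hasAdjacentArrows hV I hI hsimple hA2
  obtain ⟨a, b, ⟨α⟩⟩ : ∃ a b : V, Nonempty (a ⟶ b) := by
    rcases hadj with ⟨a, b, -, h, -⟩ | ⟨a, -, b, α, -⟩ | ⟨a, b, -, α, -⟩
    exacts [⟨a, b, h⟩, ⟨a, b, ⟨α⟩⟩, ⟨a, b, ⟨α⟩⟩]
  obtain ⟨f, hf⟩ := hD4
  have hne : ∀ {i j}, i ≠ j → f i ≠ f j := fun h => hf.ne h
  have hedge : ∀ {i}, graphD4.Adj i 2 → Nonempty (f i ⟶ f 2) ∨ Nonempty (f 2 ⟶ f i) :=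
    fun h => ((SimpleGraph.fromRel_adj _ _ _).mp (f.map_rel h)).2
  have e0 := hedge (i := 0) (by simp [graphD4])
  have e1 := hedge (i := 1) (by simp [graphD4])
  have e3 := hedge (i := 3) (by simp [graphD4])
  have n01 : f 0 ≠ f 1 := hne (by decide)
  have n03 : f 0 ≠ f 3 := hne (by decide)
  have n13 : f 1 ≠ f 3 := hne (by decide)
  have n02 : f 0 ≠ f 2 := hne (by decide)
  have n12 : f 1 ≠ f 2 := hne (by decide)
  have n32 : f 3 ≠ f 2 := hne (by decide)
  -- Up to permuting the leaves, the eight orientations are determined by the number of edges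
  -- pointing into the centre `f 2`.
  rcases e0 with ⟨⟨β₀⟩⟩ | ⟨⟨γ₀⟩⟩ <;> rcases e1 with ⟨⟨β₁⟩⟩ | ⟨⟨γ₁⟩⟩ <;>
    rcases e3 with ⟨⟨β₃⟩⟩ | ⟨⟨γ₃⟩⟩
  · exact representationInfinite_of_three_in hI hJ n01 n03 n13 α β₀ β₁ β₃
  · exact representationInfinite_of_two_in_one_out hI hJ hadj n01 n02 n12 β₀ β₁ γ₃
  · exact representationInfinite_of_two_in_one_out hI hJ hadj n03 n02 n32 β₀ β₃ γ₁
  · exact representationInfinite_of_one_in_two_out hI hJ hadj n13 n12 n32 β₀ γ₁ γ₃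
  · exact representationInfinite_of_two_in_one_out hI hJ hadj n13 n12 n32 β₁ β₃ γ₀
  · exact representationInfinite_of_one_in_two_out hI hJ hadj n03 n02 n32 β₁ γ₀ γ₃
  · exact representationInfinite_of_one_in_two_out hI hJ hadj n01 n02 n12 β₃ γ₀ γ₁
  · exact representationInfinite_of_three_out hI hJ n01 n03 n13 α γ₀ γ₁ γ₃
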